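/- Setting. A convenient space is a Hausdorff locally convex real vector space in which every Mackey–Cauchy sequence converges; a map between $c^\infty$-open subsets of convenient spaces is smooth if it sends smooth curves to smooth curves. Let $M$ be a manifold modelled on a convenient space $\mathbb M$, given by an atlas whose charts take values in $c^\infty$-open subsets of $\mathbb M$ and have smooth transition maps, with kinematic tangent bundle $TM$ and kinematic cotangent bundle $T'M$ (the fibre $T'_xM$ is the bornological dual of $T_xM$). Let $T^\flat M$ be a weak subbundle of $T'M$: a convenient vector bundle over $M$ whose fibres are subspaces $T^\flat_xM\subset T'_xM$ and whose inclusion $T^\flat M\to T'M$ is a morphism of convenient vector bundles. For $U\subset M$ open let $\mathfrak A(U)$ be the set of smooth functions $f:U\to\mathbb R$ such that for all $k\ge 1$, $x\in U$ and $u_2,\dots,u_k$ the linear form $d^k_xf(\cdot,u_2,\dots,u_k)$, computed in the charts of the atlas of $M$, belongs to $T^\flat_xM$ and depends smoothly, as an element of $T^\flat M$, on $(x,u_2,\dots,u_k)$. Let $P:T^\flat M\to TM$ be a skew-symmetric bundle morphism over $\mathrm{id}_M$, i.e. $\langle\xi,P\eta\rangle=-\langle\eta,P\xi\rangle$ for $\xi,\eta\in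 T^\flat_xM$. For $f,g\in\mathfrak A(U)$ put $\{f,g\}_P=-\langle df,P(dg)\rangle$, and for $f\in\mathfrak A(U)$ and $\varphi\in C^\infty(U)$ put $\{f,\varphi\}_P=\langle d\varphi,P(df)\rangle$; by skew-symmetry the two formulas agree when $\varphi\in\mathfrak A(U)$. $P$ is called a partial Poisson anchor if $$\{f,\{g,h\}_P\}_P+\{g,\{h,f\}_P\}_P+\{h,\{f,g\}_P\}_P=0$$ for every open $U\subset M$ and all $f,g,h\in\mathfrak A(U)$. Two partial Poisson anchors $P,Q:T^\flat M\to TM$ are called compatible if $P+Q$ is also a partial Poisson anchor. Proposition. Let $P,Q:T^\flat M\to TM$ be compatible partial Poisson anchors. For $\lambda\in[0,\infty[$ put $P_\lambda=P+\lambda Q$, and put $P_\infty=Q$. Then $P_\lambda$ is a partial Poisson anchor for every $\lambda\in[0,\infty[\,\cup\,\{\infty\}$. Moreover, if $\{\cdot,\cdot\}_P$ and $\{\cdot,\cdot\}_Q$ map $\mathfrak A(U)\times\mathfrak A(U)$ to $\mathfrak A(U)$ for every open $U$, then so does $\{\cdot,\cdot\}_{P_\lambda}$. -/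

import Mathlib

open Set Filter Topology
open scoped ENNReal

noncomputable section

/-! ### Convenient vector spaces and convenient calculus -/

section Calculus

variable {E F : Type*} [AddCommGroup E] [Module ℝ E] [TopologicalSpace E]
  [AddCommGroup F] [Module ℝ F] [TopologicalSpace F]

/-- A Mackey-Cauchy sequence: Cauchy with respect to some bounded absolutely convex set. -/
def IsMackeyCauchy (x : ℕ → E) : Prop :=
  ∃ B : Set E, Bornology.IsVonNBounded ℝ B ∧ AbsConvex ℝ B ∧
    ∀ ε : ℝ, 0 < ε → ∃ N : ℕ, ∀ m n : ℕ, N < m → m < n → x m - x n ∈ (fun b => ε • b) '' B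

/-- A convenient (`c^∞`-complete) space: a Hausdorff locally convex real topological vector space
in which every Mackey-Cauchy sequence converges. -/
class ConvenientSpace (E : Type*) [AddCommGroup E] [Module ℝ E] [TopologicalSpace E] : Prop
    extends IsTopologicalAddGroup E, ContinuousSMul ℝ E, LocallyConvexSpace ℝ E, T2Space E where
  exists_tendsto : ∀ x : ℕ → E, IsMackeyCauchy x → ∃ l : E, Tendsto x atTop (𝓝 l)

/-- The curve `c` has velocity `v` at time `t`: the difference quotients converge to `v`. -/
def HasVelocityAt (c : ℝ → E) (v : E) (t : ℝ) : Prop :=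
  Tendsto (slope c t) (𝓝[≠] t) (𝓝 v)

/-- Smooth (infinitely differentiable) curves; `d n` is the `n`-th derivative. -/
def IsSmoothCurve (c : ℝ → E) : Prop :=
  ∃ d : ℕ → ℝ → E, d 0 = c ∧ ∀ n t, HasVelocityAt (d n) (d (n + 1) t) t

/-- `f` is (conveniently) smooth on `V`: it maps smooth curves in `V` to smooth curves.
It is used for `c^∞`-open sets `V`. -/
def IsSmoothOn (f : E → F) (V : Set E) : Prop :=
  ∀ c : ℝ → E, IsSmoothCurve c → (∀ t, c t ∈ V) → IsSmoothCurve (fun t => f (c t))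

/-- `lim_{t → 0} (f (y + t u) - f y) / t = w`. -/
def HasDirDerivAt (f : E → F) (y u : E) (w : F) : Prop :=
  HasVelocityAt (fun t : ℝ => f (y + t • u)) w 0

open Classical in
/-- The differential `df(y)` of `f` at `y`: the linear map whose values are the directional
derivatives of `f` at `y` (and `0` if there is no such linear map). -/
def kDeriv (f : E → F) (y : E) : E →ₗ[ℝ] F :=
  if h : ∃ L : E →ₗ[ℝ] F, ∀ u, HasDirDerivAt f y u (L u) then h.choose else 0

/-- Iterated derivatives of a scalar function:
`iterDir [u₂, …, uₖ] g y = d^{k-1} g (y) (u₂, …, uₖ)`. -/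
def iterDir : List E → (E → ℝ) → E → ℝ
  | [], g => g
  | u :: us, g => fun y => deriv (fun t : ℝ => iterDir us g (y + t • u)) 0

variable (E) in
/-- The bornological dual `E'`: linear forms that are bounded on bounded sets. -/
def boundedDual [IsTopologicalAddGroup E] [ContinuousSMul ℝ E] :
    Submodule ℝ (Module.Dual ℝ E) where
  carrier := {l | ∀ B : Set E, Bornology.IsVonNBounded ℝ B → Bornology.IsVonNBounded ℝ (l '' B)}
  zero_mem' := by
    intro B _
    refine (Bornology.isVonNBounded_singleton (𝕜 := ℝ) (0 : ℝ)).subset ?_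
    rintro _ ⟨b, _, rfl⟩
    simp
  add_mem' := by
    intro l m hl hm B hB
    refine ((hl B hB).add (hm B hB)).subset ?_
    rintro _ ⟨b, hb, rfl⟩
    exact Set.add_mem_add ⟨b, hb, rfl⟩ ⟨b, hb, rfl⟩
  smul_mem' := by
    intro r l hl B hB
    have h := (hl B hB).image (σ := RingHom.id ℝ) (r • ContinuousLinearMap.id ℝ ℝ)
    refine h.subset ?_
    rintro _ ⟨b, hb, rfl⟩
    exact ⟨l b, ⟨b, hb, rfl⟩, by simp⟩

variable (E) in
/-- The `c^∞`-topology on `E`: the final topology for all smooth curves. -/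
abbrev cInfTopology : TopologicalSpace E :=
  ⨆ c : {c : ℝ → E // IsSmoothCurve c}, TopologicalSpace.coinduced c.1 inferInstance

variable (E) in
/-- The space `E` with its `c^∞`-topology. -/
def CInf : Type _ := E

instance : TopologicalSpace (CInf E) := cInfTopology E

/-- A set is `c^∞`-open iff its preimages under all smooth curves are open. -/
theorem isOpen_cInfTopology_iff {V : Set E} :
    IsOpen[cInfTopology E] V ↔ ∀ c : ℝ → E, IsSmoothCurve c → IsOpen (c ⁻¹' V) := by
  unfold cInfTopology
  rw [isOpen_iSup_iff]
  simp [isOpen_coinduced]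

end Calculus

/-! ### Convenient manifolds -/

section Manifold

variable {E M : Type*} [AddCommGroup E] [Module ℝ E] [TopologicalSpace E] [TopologicalSpace M]

/-- The value of a chart, as a vector of the model space. -/
def chartVal (e : OpenPartialHomeomorph M (CInf E)) (x : M) : E := e x

/-- The point of the manifold with given coordinates in a chart. -/
def chartInv (e : OpenPartialHomeomorph M (CInf E)) (y : E) : M := e.symm y

/-- The part of the coordinate domain of `e` that lies in `U`. -/
def chartDom (e : OpenPartialHomeomorph M (CInf E)) (U : Set M) : Set E :=
  {y | y ∈ e.target ∧ chartInv e y ∈ U}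

variable (E M) in
/-- A manifold modelled on `c^∞`-open subsets of the convenient space `E`, with smooth chart
changes. -/
class IsConvenientManifold [ChartedSpace (CInf E) M] : Prop where
  smooth_change : ∀ e ∈ atlas (CInf E) M, ∀ e' ∈ atlas (CInf E) M,
    IsSmoothOn (fun y => chartVal e' (chartInv e y)) (chartDom e e'.source)

variable [ChartedSpace (CInf E) M]

variable (E) in
/-- The kinematic tangent space `T_x M`; a kinematic tangent vector is identified with its
representative in the preferred chart at `x`. -/
abbrev KTangent (_x : M) : Type _ := E

variable (E) in
/-- The kinematic cotangent space `T'_x M`: the bornological dual of `T_x M`. -/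
abbrev KCotangent [IsTopologicalAddGroup E] [ContinuousSMul ℝ E] (x : M) :
    Submodule ℝ (Module.Dual ℝ (KTangent E x)) := boundedDual E

/-- The tangent map of the chart `e` at `x`: it sends a tangent vector to its representative
in `e`. -/
def toChart (e : OpenPartialHomeomorph M (CInf E)) (x : M) : KTangent E x →ₗ[ℝ] E :=
  kDeriv (fun y => chartVal e (chartInv (chartAt (CInf E) x) y)) (chartVal (chartAt (CInf E) x) x)

/-- The tangent vector at `x` represented in the chart `e` by a given vector. -/
def ofChart (e : OpenPartialHomeomorph M (CInf E)) (x : M) : E →ₗ[ℝ] KTangent E x :=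
  kDeriv (fun y => chartVal (chartAt (CInf E) x) (chartInv e y)) (chartVal e x)

variable (E) in
/-- `f` is smooth on the open set `U`. Functions on `U` are represented by functions on `M`
whose values outside `U` play no role. -/
def IsSmoothFun (U : Set M) (f : M → ℝ) : Prop :=
  ∀ e ∈ atlas (CInf E) M, IsSmoothOn (fun y => f (chartInv e y)) (chartDom e U)

/-- The differential of `f` at `x` is the linear form `α` on `T_x M`. -/
def HasDifferentialAt (f : M → ℝ) (x : M) (α : Module.Dual ℝ (KTangent E x)) : Prop :=
  ∀ u : E, HasDirDerivAt (fun y => f (chartInv (chartAt (CInf E) x) y))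
    (chartVal (chartAt (CInf E) x) x) u (α u)

end Manifold

/-! ### Weak subbundles of the cotangent bundle and partial Poisson anchors -/

section Poisson

variable (E M F : Type*) [AddCommGroup E] [Module ℝ E] [TopologicalSpace E] [ConvenientSpace E]
  [TopologicalSpace M] [ChartedSpace (CInf E) M]
  [AddCommGroup F] [Module ℝ F] [TopologicalSpace F]

/-- A weak subbundle `T♭M` of the kinematic cotangent bundle `T'M`: subspaces `T♭_x M` of the
spaces `T'_x M` that form a convenient vector bundle with typical fibre `F` such that the
inclusion in `T'M` is a morphism of convenient vector bundles. The bundle `T♭M` may carry a finer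
structure than the one induced by `T'M`. -/
structure WeakSubbundle where
  fiber : ∀ x : M, Submodule ℝ (Module.Dual ℝ (KTangent E x))
  fiber_le : ∀ x, fiber x ≤ KCotangent E x
  /-- A vector bundle atlas, indexed by the points of `M`. -/
  baseSet : M → Set M
  isOpen_baseSet : ∀ i, IsOpen (baseSet i)
  mem_baseSet : ∀ x, x ∈ baseSet x
  /-- The local trivialization `coord i : T♭_x M ≃ F`; only the points `x` of `baseSet i`
  matter. -/
  coord : ∀ _i x : M, fiber x ≃ₗ[ℝ] F
  /-- The changes of trivialization are smooth. -/
  smooth_coord_change : ∀ e ∈ atlas (CInf E) M, ∀ i j : M,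
    IsSmoothOn (fun p : E × F => coord j (chartInv e p.1) ((coord i (chartInv e p.1)).symm p.2))
      {p | p.1 ∈ chartDom e (baseSet i ∩ baseSet j)}
  /-- The inclusion of `T♭M` in `T'M` is smooth: in a chart and a trivialization it is a smooth
  map with values in the dual of `E`, which by the exponential law means that the
  pairing with vectors of `E` is smooth. -/
  smooth_inclusion : ∀ e ∈ atlas (CInf E) M, ∀ i : M,
    IsSmoothOn (fun p : E × F × E =>
        ((coord i (chartInv e p.1)).symm p.2.1).1 (ofChart e (chartInv e p.1) p.2.2))
      {p | p.1 ∈ chartDom e (baseSet i)}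

variable {E M F}

namespace WeakSubbundle

variable (T : WeakSubbundle E M F)

/-- The algebra `𝔄(U)`: the smooth functions `f` on `U` such that for all `k ≥ 1` the linear form
`d^k_x f(·, u₂, …, uₖ)` belongs to `T♭_x M`, and depends smoothly on `(x, u₂, …, uₖ)` as an element
of `T♭M`. The derivatives are those in the charts of the manifold; `n = k - 1`, and `β` is the
derivative written in the trivialization `coord i`. -/
def MemA (U : Set M) (f : M → ℝ) : Prop :=
  IsSmoothFun E U f ∧
  ∀ e ∈ atlas (CInf E) M, ∀ (i : M) (n : ℕ), ∃ β : E × (Fin n → E) → F,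
    IsSmoothOn β {p | p.1 ∈ chartDom e (U ∩ T.baseSet i)} ∧
    ∀ y ∈ chartDom e (U ∩ T.baseSet i), ∀ us : Fin n → E, ∀ u : E,
      HasDirDerivAt (iterDir (List.ofFn us) (fun z => f (chartInv e z))) y u
        (((T.coord i (chartInv e y)).symm (β (y, us))).1 (ofChart e (chartInv e y) u))

open Classical in
/-- The differential of `f` at `x` as an element of `T♭_x M` (and `0` if it is not one). -/
def dFlat (f : M → ℝ) (x : M) : T.fiber x :=
  if h : ∃ α : T.fiber x, HasDifferentialAt f x α.1 then h.choose else 0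

/-- A fibrewise linear map `P : T♭M → TM` over the identity of `M`. -/
abbrev Hom : Type _ := ∀ x : M, T.fiber x →ₗ[ℝ] KTangent E x

variable {T}

/-- `P` is smooth, hence a morphism of convenient vector bundles. -/
def IsBundleMorphism (P : T.Hom) : Prop :=
  ∀ e ∈ atlas (CInf E) M, ∀ i : M,
    IsSmoothOn (fun p : E × F => toChart e (chartInv e p.1)
        (P (chartInv e p.1) ((T.coord i (chartInv e p.1)).symm p.2)))
      {p | p.1 ∈ chartDom e (T.baseSet i)}

/-- A quasi-Poisson anchor: a skew-symmetric bundle morphism `P : T♭M → TM`. -/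
structure IsQuasiPoissonAnchor (P : T.Hom) : Prop where
  morphism : IsBundleMorphism P
  skew : ∀ (x : M) (ξ η : T.fiber x), ξ.1 (P x η) = - η.1 (P x ξ)

/-- The bracket `{f, g}_P = -⟨df, P (dg)⟩` of functions in `𝔄(U)`. -/
def bracket (P : T.Hom) (f g : M → ℝ) (x : M) : ℝ :=
  - (T.dFlat f x).1 (P x (T.dFlat g x))

/-- `{f, φ}_P` has the value `r` at `x`, for `f` in `𝔄(U)` and a function `φ` with a
differential in `T'_x M`: that value is `⟨dφ, P (df)⟩`, the derivative of `φ` along the Hamiltonian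
field of `f`. -/
def HasBracketAt (P : T.Hom) (f φ : M → ℝ) (x : M) (r : ℝ) : Prop :=
  ∃ a ∈ KCotangent E x, HasDifferentialAt φ x a ∧ a (P x (T.dFlat f x)) = r

/-- If `dφ` belongs to `T♭_x M`, then `⟨dφ, P (df)⟩ = -⟨df, P (dφ)⟩`, so that the two
definitions of the bracket agree. -/
theorem hasBracketAt_bracket {P : T.Hom} (hP : IsQuasiPoissonAnchor P) (f φ : M → ℝ) (x : M)
    (h : ∃ α : T.fiber x, HasDifferentialAt φ x α.1) :
    HasBracketAt P f φ x (bracket P f φ x) := by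
  refine ⟨(T.dFlat φ x).1, T.fiber_le x (T.dFlat φ x).2, ?_, ?_⟩
  · rw [dFlat, dif_pos h]
    exact h.choose_spec
  · rw [bracket]
    exact hP.skew x _ _

/-- A partial Poisson anchor: a quasi-Poisson anchor whose bracket satisfies the Jacobi identity
`{f, {g, h}} + {g, {h, f}} + {h, {f, g}} = 0` on `𝔄(U)` for every open `U`. -/
structure IsPartialPoissonAnchor (P : T.Hom) : Prop extends IsQuasiPoissonAnchor P where
  jacobi : ∀ U : Set M, IsOpen U → ∀ f g h : M → ℝ, T.MemA U f → T.MemA U g → T.MemA U h →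
    ∀ x ∈ U, ∃ r s t : ℝ,
      HasBracketAt P f (bracket P g h) x r ∧ HasBracketAt P g (bracket P h f) x s ∧
      HasBracketAt P h (bracket P f g) x t ∧ r + s + t = 0

/-- The bracket of `P` takes its values in `𝔄(U)`. -/
def BracketClosed (P : T.Hom) : Prop :=
  ∀ U : Set M, IsOpen U → ∀ f g : M → ℝ, T.MemA U f → T.MemA U g → T.MemA U (bracket P f g)

/-- Two partial Poisson anchors on the same `T♭M` are compatible if their sum is again one. -/
structure Compatible (P Q : T.Hom) : Prop where
  left : IsPartialPoissonAnchor P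
  right : IsPartialPoissonAnchor Q
  add : IsPartialPoissonAnchor (P + Q)

open Classical in
/-- The pencil `P_l = P + l Q` for `l ∈ [0, ∞[`, and `P_∞ = Q`. -/
def pencil (P Q : T.Hom) (l : ℝ≥0∞) : T.Hom :=
  if l = ⊤ then Q else P + l.toReal • Q

end WeakSubbundle

end Poisson

end

open Set Filter Topology
open scoped ENNReal

/-! ### Linear combinations of smooth curves and maps; affine lines. -/

section LinearCombinations

variable {E F : Type*} [AddCommGroup E] [Module ℝ E] [TopologicalSpace E]
  [AddCommGroup F] [Module ℝ F] [TopologicalSpace F]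

/-! The bracket is linear in the anchor, so the Jacobi sum of `P + a • Q` is a quadratic polynomial
in `a`: J(P) + a M + a² J(Q), with a mixed term M. Here J(P) = J(Q) = 0, and compatibility, the case
a = 1, gives M = J(P + Q) - J(P) - J(Q) = 0. Hence the polynomial vanishes for every real `a`.
`HasBracketAt.pencil` is this expansion for one term of the sum.

For closedness under brackets, linearity reduces the claim to the stability of 𝔄(U) under f + a g
(`MemA.add_smul`). The difficulty is that `iterDir` is built from `deriv`, additive only where
derivatives exist; membership in 𝔄(U) supplies them. -/

theorem HasVelocityAt.add_smul [IsTopologicalAddGroup E] [ContinuousSMul ℝ E] {c d : ℝ → E}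
    {v w : E} {t : ℝ} (hc : HasVelocityAt c v t) (hd : HasVelocityAt d w t) (a : ℝ) :
    HasVelocityAt (fun s => c s + a • d s) (v + a • w) t := by
  refine (Tendsto.add hc (Tendsto.const_smul hd a)).congr fun s => ?_
  simp only [slope_def_module, smul_sub, smul_add, smul_comm a]
  abel

theorem IsSmoothCurve.add_smul [IsTopologicalAddGroup E] [ContinuousSMul ℝ E] {c d : ℝ → E}
    (hc : IsSmoothCurve c) (hd : IsSmoothCurve d) (a : ℝ) :
    IsSmoothCurve (fun s => c s + a • d s) := by
  obtain ⟨c', rfl, hc'⟩ := hc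
  obtain ⟨d', rfl, hd'⟩ := hd
  exact ⟨fun n s => c' n s + a • d' n s, rfl, fun n t => (hc' n t).add_smul (hd' n t) a⟩

theorem IsSmoothOn.add_smul [IsTopologicalAddGroup F] [ContinuousSMul ℝ F] {f g : E → F}
    {V : Set E} (hf : IsSmoothOn f V) (hg : IsSmoothOn g V) (a : ℝ) :
    IsSmoothOn (fun y => f y + a • g y) V :=
  fun c hc hV => (hf c hc hV).add_smul (hg c hc hV) a

theorem hasVelocityAt_iff_hasDerivAt {c : ℝ → ℝ} {v t : ℝ} :
    HasVelocityAt c v t ↔ HasDerivAt c v t :=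
  hasDerivAt_iff_tendsto_slope.symm

/-- An affine line is a smooth curve. -/
theorem isSmoothCurve_line [IsTopologicalAddGroup E] [ContinuousSMul ℝ E] (y u : E) :
    IsSmoothCurve (fun t : ℝ => y + t • u) := by
  -- The successive derivatives are the line itself, the constant `u`, then 0 forever.
  refine ⟨fun n => Nat.rec (fun t => y + t • u) (fun k _ => Nat.rec (fun _ => u)
    (fun _ _ _ => 0) k) n, rfl, ?_⟩
  rintro (_ | _ | n) t
  · refine (tendsto_const_nhds (x := u)).congr' ?_
    filter_upwards [self_mem_nhdsWithin] with s hs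
    have hs' : s - t ≠ 0 := sub_ne_zero.2 hs
    change u = slope (fun t : ℝ => y + t • u) t s
    simp only [slope_def_module, add_sub_add_left_eq_sub, ← sub_smul, smul_smul,
      inv_mul_cancel₀ hs', one_smul]
  all_goals
    refine (tendsto_const_nhds (x := (0 : E))).congr fun s => ?_
    simp [slope_def_module]

end LinearCombinations

section DirectionalDerivatives

variable {E F : Type*} [AddCommGroup E] [Module ℝ E]
  [AddCommGroup F] [Module ℝ F] [TopologicalSpace F]

theorem HasDirDerivAt.unique [T2Space F] {f : E → F} {y u : E} {v w : F}
    (hv : HasDirDerivAt f y u v) (hw : HasDirDerivAt f y u w) : v = w :=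
  tendsto_nhds_unique hv hw

theorem HasDirDerivAt.add_smul [IsTopologicalAddGroup F] [ContinuousSMul ℝ F] {f g : E → F}
    {y u : E} {v w : F} (hf : HasDirDerivAt f y u v) (hg : HasDirDerivAt g y u w) (a : ℝ) :
    HasDirDerivAt (fun z => f z + a • g z) y u (v + a • w) :=
  HasVelocityAt.add_smul hf hg a

end DirectionalDerivatives

section ChartDomain

variable {E M : Type*} [AddCommGroup E] [Module ℝ E] [TopologicalSpace E] [TopologicalSpace M]

theorem isOpen_chartDom (e : OpenPartialHomeomorph M (CInf E)) {U : Set M} (hU : IsOpen U) :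
    IsOpen[cInfTopology E] (chartDom e U) :=
  e.isOpen_inter_preimage_symm hU

/-- Chart domains are only `c^∞`-open, but affine lines are smooth curves, so their preimages under
lines are open in ℝ. -/
theorem eventually_line_mem_chartDom [IsTopologicalAddGroup E] [ContinuousSMul ℝ E]
    (e : OpenPartialHomeomorph M (CInf E)) {U : Set M} (hU : IsOpen U) {y : E}
    (hy : y ∈ chartDom e U) (u : E) : ∀ᶠ t : ℝ in 𝓝 0, y + t • u ∈ chartDom e U :=
  (isOpen_cInfTopology_iff.1 (isOpen_chartDom e hU) _ (isSmoothCurve_line y u)).mem_nhds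
    (by simpa using hy)

variable [ChartedSpace (CInf E) M]

theorem HasDifferentialAt.unique {f : M → ℝ} {x : M} {α β : Module.Dual ℝ (KTangent E x)}
    (hα : HasDifferentialAt f x α) (hβ : HasDifferentialAt f x β) : α = β :=
  LinearMap.ext fun u => (hα u).unique (hβ u)

theorem HasDifferentialAt.add_smul {f g : M → ℝ} {x : M} {α β : Module.Dual ℝ (KTangent E x)}
    (hα : HasDifferentialAt f x α) (hβ : HasDifferentialAt g x β) (a : ℝ) :
    HasDifferentialAt (fun z => f z + a * g z) x (α + a • β) :=
  fun u => (hα u).add_smul (hβ u) a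

end ChartDomain

namespace WeakSubbundle

variable {E M F : Type*} [AddCommGroup E] [Module ℝ E] [TopologicalSpace E] [ConvenientSpace E]
  [TopologicalSpace M] [ChartedSpace (CInf E) M]
  [AddCommGroup F] [Module ℝ F] [TopologicalSpace F] {T : WeakSubbundle E M F}

/-! ### Anchors and the Jacobi identity along the pencil. -/

theorem bracket_add_smul (P Q : T.Hom) (a : ℝ) (f g : M → ℝ) :
    bracket (P + a • Q) f g = fun x => bracket P f g x + a * bracket Q f g x := by
  funext x
  simp only [bracket, Pi.add_apply, Pi.smul_apply, LinearMap.add_apply, LinearMap.smul_apply,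
    map_add, map_smul, smul_eq_mul]
  ring

theorem IsBundleMorphism.add_smul {P Q : T.Hom} (hP : IsBundleMorphism P)
    (hQ : IsBundleMorphism Q) (a : ℝ) : IsBundleMorphism (P + a • Q) := by
  intro e he i
  have h := (hP e he i).add_smul (hQ e he i) a
  simpa only [Pi.add_apply, Pi.smul_apply, LinearMap.add_apply, LinearMap.smul_apply,
    map_add, map_smul] using h

theorem IsQuasiPoissonAnchor.add_smul {P Q : T.Hom} (hP : IsQuasiPoissonAnchor P)
    (hQ : IsQuasiPoissonAnchor Q) (a : ℝ) : IsQuasiPoissonAnchor (P + a • Q) where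
  morphism := hP.morphism.add_smul hQ.morphism a
  skew x ξ η := by
    simp only [Pi.add_apply, Pi.smul_apply, LinearMap.add_apply, LinearMap.smul_apply,
      map_add, map_smul, smul_eq_mul, hP.skew x ξ η, hQ.skew x ξ η]
    ring

/-- The value at `x` of `{f, {g, h}_{P + aQ}}_{P + aQ}` is a quadratic polynomial in `a`, whose
mixed coefficient is determined by the value at `a = 1`. -/
theorem HasBracketAt.pencil {P Q : T.Hom} {f g h : M → ℝ} {x : M} {rP rQ rPQ : ℝ}
    (hP : HasBracketAt P f (bracket P g h) x rP) (hQ : HasBracketAt Q f (bracket Q g h) x rQ)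
    (hPQ : HasBracketAt (P + Q) f (bracket (P + Q) g h) x rPQ) (a : ℝ) :
    HasBracketAt (P + a • Q) f (bracket (P + a • Q) g h) x
      (rP + a * (rPQ - rP - rQ) + a ^ 2 * rQ) := by
  obtain ⟨α, hα, dα, rfl⟩ := hP
  obtain ⟨β, hβ, dβ, rfl⟩ := hQ
  obtain ⟨γ, -, dγ, rfl⟩ := hPQ
  -- The bracket of `P + Q` is the sum of the two brackets, so uniqueness of differentials forces γ
  -- = α + β. Thus the mixed coefficient is α(Q df) + β(P df).
  have dsum := dα.add_smul dβ 1
  rw [← bracket_add_smul, one_smul, one_smul] at dsum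
  obtain rfl := dγ.unique dsum
  refine ⟨α + a • β, Submodule.add_mem _ hα (Submodule.smul_mem _ a hβ), ?_, ?_⟩
  · rw [bracket_add_smul]
    exact dα.add_smul dβ a
  · simp only [Pi.add_apply, Pi.smul_apply, LinearMap.add_apply, LinearMap.smul_apply,
      map_add, map_smul, smul_eq_mul]
    ring

theorem Compatible.isPartialPoissonAnchor_add_smul {P Q : T.Hom} (hPQ : Compatible P Q) (a : ℝ) :
    IsPartialPoissonAnchor (P + a • Q) where
  toIsQuasiPoissonAnchor :=
    hPQ.left.toIsQuasiPoissonAnchor.add_smul hPQ.right.toIsQuasiPoissonAnchor a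
  jacobi U hU f g h hf hg hh x hx := by
    obtain ⟨r₁, s₁, t₁, hr₁, hs₁, ht₁, h₁⟩ := hPQ.left.jacobi U hU f g h hf hg hh x hx
    obtain ⟨r₂, s₂, t₂, hr₂, hs₂, ht₂, h₂⟩ := hPQ.right.jacobi U hU f g h hf hg hh x hx
    obtain ⟨r₃, s₃, t₃, hr₃, hs₃, ht₃, h₃⟩ := hPQ.add.jacobi U hU f g h hf hg hh x hx
    refine ⟨_, _, _, hr₁.pencil hr₂ hr₃ a, hs₁.pencil hs₂ hs₃ a, ht₁.pencil ht₂ ht₃ a, ?_⟩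
    -- J(P) + a (J(P + Q) - J(P) - J(Q)) + a² J(Q), regrouped by Jacobi sums.
    linear_combination (1 - a) * h₁ + (a ^ 2 - a) * h₂ + a * h₃

/-! ### Stability of 𝔄(U) under linear combinations. -/

theorem MemA.hasDirDerivAt_iterDir {U : Set M} {f : M → ℝ} (hf : T.MemA U f)
    {e : OpenPartialHomeomorph M (CInf E)} (he : e ∈ atlas (CInf E) M) {y : E}
    (hy : y ∈ chartDom e U) (us : List E) (u : E) :
    ∃ r : ℝ, HasDirDerivAt (iterDir us fun z => f (chartInv e z)) y u r := by
  -- The trivialization indexed by the point itself is used, since its base set contains that point.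
  obtain ⟨β, -, hβ⟩ := hf.2 e he (chartInv e y) us.length
  have h := hβ y ⟨hy.1, hy.2, T.mem_baseSet _⟩ us.get u
  rw [List.ofFn_get] at h
  exact ⟨_, h⟩

theorem MemA.iterDir_add_smul {U : Set M} (hU : IsOpen U) {f g : M → ℝ} (hf : T.MemA U f)
    (hg : T.MemA U g) (a : ℝ) {e : OpenPartialHomeomorph M (CInf E)}
    (he : e ∈ atlas (CInf E) M) (us : List E) {y : E} (hy : y ∈ chartDom e U) :
    iterDir us (fun z => f (chartInv e z) + a * g (chartInv e z)) y =
      iterDir us (fun z => f (chartInv e z)) y + a * iterDir us (fun z => g (chartInv e z)) y := by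
  induction us generalizing y with
  | nil => rfl
  | cons u us ih =>
    obtain ⟨r, hr⟩ := hf.hasDirDerivAt_iterDir he hy us u
    obtain ⟨s, hs⟩ := hg.hasDirDerivAt_iterDir he hy us u
    have hr' := hasVelocityAt_iff_hasDerivAt.1 hr
    have hs' := hasVelocityAt_iff_hasDerivAt.1 hs
    -- Differentiating the induction hypothesis needs it on a whole neighbourhood of `y` in the
    -- line, hence the generalization over `y`.
    have heq : (fun t : ℝ => iterDir us
          (fun z => f (chartInv e z) + a * g (chartInv e z)) (y + t • u)) =ᶠ[𝓝 0]
        fun t => iterDir us (fun z => f (chartInv e z)) (y + t • u) +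
          a * iterDir us (fun z => g (chartInv e z)) (y + t • u) :=
      (eventually_line_mem_chartDom e hU hy u).mono fun t ht => ih ht
    simp only [iterDir]
    rw [heq.deriv_eq, (hr'.fun_add (hs'.const_mul a)).deriv, hr'.deriv, hs'.deriv]

/-- Trivializations are linear on fibres, so the local representatives of the derivatives combine as
β + a γ. -/
theorem MemA.add_smul [IsTopologicalAddGroup F] [ContinuousSMul ℝ F] {U : Set M} (hU : IsOpen U)
    {f g : M → ℝ} (hf : T.MemA U f) (hg : T.MemA U g) (a : ℝ) :
    T.MemA U (fun x => f x + a * g x) := by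
  refine ⟨fun e he => (hf.1 e he).add_smul (hg.1 e he) a, fun e he i n => ?_⟩
  obtain ⟨β, sβ, hβ⟩ := hf.2 e he i n
  obtain ⟨γ, sγ, hγ⟩ := hg.2 e he i n
  refine ⟨_, sβ.add_smul sγ a, fun y hy us u => ?_⟩
  have hyU : y ∈ chartDom e U := ⟨hy.1, hy.2.1⟩
  have h := hasVelocityAt_iff_hasDerivAt.1 ((hβ y hy us u).add_smul (hγ y hy us u) a)
  have heq := (eventually_line_mem_chartDom e hU hyU u).mono fun t ht =>
    hf.iterDir_add_smul hU hg a he (List.ofFn us) ht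
  simp only [map_add, map_smul]
  -- `h` differentiates the combination of the two `iterDir`s, which agrees with the `iterDir` of
  -- the combination for small t.
  exact hasVelocityAt_iff_hasDerivAt.2 (h.congr_of_eventuallyEq heq)

theorem BracketClosed.add_smul [IsTopologicalAddGroup F] [ContinuousSMul ℝ F] {P Q : T.Hom}
    (hP : BracketClosed P) (hQ : BracketClosed Q) (a : ℝ) : BracketClosed (P + a • Q) := by
  intro U hU f g hf hg
  rw [bracket_add_smul]
  exact (hP U hU f g hf hg).add_smul hU (hQ U hU f g hf hg) a

end WeakSubbundle

theorem mainTheorem5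
    {E M F : Type*}
    [AddCommGroup E] [Module ℝ E] [TopologicalSpace E] [ConvenientSpace E]
    [AddCommGroup F] [Module ℝ F] [TopologicalSpace F] [ConvenientSpace F]
    [TopologicalSpace M] [ChartedSpace (CInf E) M] [IsConvenientManifold E M]
    (T : WeakSubbundle E M F) (P Q : T.Hom) (hPQ : WeakSubbundle.Compatible P Q)
    (l : ℝ≥0∞) :
    WeakSubbundle.IsPartialPoissonAnchor (WeakSubbundle.pencil P Q l) ∧
    (WeakSubbundle.BracketClosed P → WeakSubbundle.BracketClosed Q →
      WeakSubbundle.BracketClosed (WeakSubbundle.pencil P Q l)) := by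
  by_cases hl : l = ⊤
  · rw [WeakSubbundle.pencil, if_pos hl]
    exact ⟨hPQ.right, fun _ hQ => hQ⟩
  · rw [WeakSubbundle.pencil, if_neg hl]
    exact ⟨hPQ.isPartialPoissonAnchor_add_smul _, fun hP hQ => hP.add_smul hQ _⟩
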